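/- Let $a_0,a_1,a_2,\dots$ be i.i.d. standard complex Gaussian random variables (density $\frac1\pi e^{-|z|^2}$ with respect to Lebesgue measure on $\mathbb{C}$), and let $$\mathbf g(z)=\sum_{n=0}^{\infty}\frac{a_n}{\sqrt{n!}}\,z^n$$ be the planar Gaussian analytic function, which is almost surely an entire function. For $r>0$ let $n(r)$ denote the number of zeros of $\mathbf g$, counted with multiplicity, in the disk $\{z\in\mathbb{C}:|z|<r\}$. Fix real numbers $\alpha>2$ and $\gamma>0$. Then, as $r\to\infty$, $$\mathbf P\left[n(r)\ge r^2+\gamma r^{\alpha}\right]=\exp\left(-\left(\frac{\alpha}{2}-1\right)\gamma^2 r^{2\alpha}\log r\,(1+o(1))\right).$$ Here the $o(1)$ term tends to $0$ as $r\to\infty$ for fixed $\alpha$ and $\gamma$. -/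

import Mathlib

open MeasureTheory ProbabilityTheory Filter Topology
open scoped ENNReal

noncomputable section

/-- The standard complex Gaussian distribution: the measure on `ℂ` with density
`π⁻¹ * exp (-|z|²)` with respect to Lebesgue measure. -/
def stdComplexGaussian : Measure ℂ :=
  (volume : Measure ℂ).withDensity
    (fun z => ENNReal.ofReal (Real.pi⁻¹ * Real.exp (-‖z‖ ^ 2)))

/-- The power series `∑ aₙ zⁿ / √(n!)`. When the `aₙ` are i.i.d. standard complex Gaussians it is
almost surely an entire function of `z`, the planar Gaussian analytic function. -/
def planarGAF (a : ℕ → ℂ) (z : ℂ) : ℂ :=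
  ∑' n : ℕ, a n * z ^ n / (Real.sqrt (n.factorial : ℝ) : ℂ)

/-- The number of zeros, counted with multiplicity, of an analytic function `f` in the open disk
of radius `r` around `0` (possibly `∞`, when `f` vanishes identically). -/
def zeroCount (f : ℂ → ℂ) (r : ℝ) : ℝ≥0∞ :=
  ∑' z : Metric.ball (0 : ℂ) r, (analyticOrderAt f (z : ℂ) : ℝ≥0∞)

end

/-! Having `m` zeros in the disk of radius `r` costs about as much as forcing `|a_n| ≲ (r/√m)^(m-n)`
for all `n < m`. A Gaussian lies in a disk of radius `t` with probability of order `t²`, and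
`∑_{n<m} 2(m-n) = m² + m`, so the cost is `exp(-m² log(√m/r))` up to factors `exp(O(m²))`. With `m`
of order `r^α`, `log(√m/r) ~ (α/2-1) log r`, which dominates the constants.

Upper bound, `m = ⌊r² + γ r^α⌋`: outside a doubly exponentially rare event `|a_n| ≤ e^m 2^n`, so the
function is `e^{O(m)}` on `|z| = √m`. Dividing out `m` zeros (`norm_le_of_le_zeroCount`) makes it at
most `e^{O(m)} (r/√m)^m` on `|z| = r`, and Cauchy's estimate makes the first `m` coefficients small
(`norm_coeff_le_of_le_zeroCount`).

Lower bound, `m ≈ (1+δ)(r² + γ r^α)`: if the first `m` coefficients are small and the later ones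
tame, the term of index `m` dominates on the annulus `r/K ≤ |z| ≤ r` (`norm_planarGAF_sub_le`). The
function then grows by a factor of about `K^m` across it, whereas `k` zeros allow only `(2K)^k`
(`exists_le_of_zeroCount_lt`). For large `K` this forces at least `m/(1+δ)` zeros
(`le_zeroCount_of_coeff_le`). Finally `δ → 0`. -/

/-! ### Growth and Cauchy estimates for the power series -/

/-- Squaring reduces this to `y^n / n! ≤ e^y` with `y = (2x)²`. The factor `2^{-n}` is split off so
that a geometric series gives both convergence and the size of the sum. -/
lemma pow_div_sqrt_factorial_le (x : ℝ) (n : ℕ) :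
    x ^ n / √(n.factorial : ℝ) ≤ (1 / 2) ^ n * Real.exp (2 * x ^ 2) := by
  have h1 : (2 * x) ^ n / √(n.factorial : ℝ) ≤ Real.exp (2 * x ^ 2) := by
    refine abs_le_of_sq_le_sq' ?_ (Real.exp_pos _).le |>.2
    rw [div_pow, Real.sq_sqrt (by positivity), ← Real.exp_nat_mul, ← pow_mul, mul_comm n, pow_mul]
    refine (Real.pow_div_factorial_le_exp _ (by positivity) n).trans (Real.exp_le_exp.2 ?_)
    push_cast; nlinarith
  calc x ^ n / √(n.factorial : ℝ) = (1 / 2) ^ n * ((2 * x) ^ n / √(n.factorial : ℝ)) := by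
        rw [mul_pow, ← mul_div_assoc, ← mul_assoc, ← mul_pow]; norm_num
    _ ≤ _ := by gcongr

lemma norm_planarGAF_term (a : ℕ → ℂ) (z : ℂ) (n : ℕ) :
    ‖a n * z ^ n / (√(n.factorial : ℝ) : ℂ)‖ = ‖a n‖ * (‖z‖ ^ n / √(n.factorial : ℝ)) := by
  rw [norm_div, norm_mul, norm_pow, Complex.norm_real, Real.norm_of_nonneg (by positivity),
    mul_div_assoc]

lemma planarGAF_term_le {a : ℕ → ℂ} {B c : ℝ} (hB : 0 ≤ B)
    (h : ∀ n, ‖a n‖ ≤ B * c ^ n) {x : ℝ} (hx : 0 ≤ x) (n : ℕ) :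
    ‖a n‖ * (x ^ n / √(n.factorial : ℝ)) ≤ B * Real.exp (2 * (c * x) ^ 2) * (1 / 2) ^ n := by
  calc ‖a n‖ * (x ^ n / √(n.factorial : ℝ)) ≤ (B * c ^ n) * (x ^ n / √(n.factorial : ℝ)) := by
        gcongr; exact h n
    _ = B * ((c * x) ^ n / √(n.factorial : ℝ)) := by rw [mul_pow]; ring
    _ ≤ B * ((1 / 2) ^ n * Real.exp (2 * (c * x) ^ 2)) := by
        gcongr; exact pow_div_sqrt_factorial_le _ n
    _ = _ := by ring

lemma summable_planarGAF_term {a : ℕ → ℂ} {B c : ℝ} (hB : 0 ≤ B)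
    (h : ∀ n, ‖a n‖ ≤ B * c ^ n) {x : ℝ} (hx : 0 ≤ x) :
    Summable fun n => ‖a n‖ * (x ^ n / √(n.factorial : ℝ)) :=
  Summable.of_nonneg_of_le (fun n => by positivity) (planarGAF_term_le hB h hx)
    ((summable_geometric_of_lt_one (by norm_num) (by norm_num)).mul_left _)

lemma hasFPowerSeriesOnBall_planarGAF {a : ℕ → ℂ} {B c : ℝ} (hB : 0 ≤ B)
    (h : ∀ n, ‖a n‖ ≤ B * c ^ n) :
    HasFPowerSeriesOnBall (planarGAF a)
      (FormalMultilinearSeries.ofScalars ℂ fun n => a n / (√(n.factorial : ℝ) : ℂ)) 0 ⊤ := by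
  set p := FormalMultilinearSeries.ofScalars ℂ fun n => a n / (√(n.factorial : ℝ) : ℂ) with hp
  have hr : p.radius = ⊤ := by
    refine p.radius_eq_top_of_summable_norm fun x => ?_
    refine (summable_planarGAF_term hB h x.2).congr fun n => ?_
    rw [hp, FormalMultilinearSeries.ofScalars_norm, norm_div, Complex.norm_real,
      Real.norm_of_nonneg (by positivity)]
    simp only [NNReal.val_eq_coe]
    ring
  have h2 := p.hasFPowerSeriesOnBall (by rw [hr]; simp)
  rw [hr] at h2
  refine h2.congr fun z _ => ?_
  simp only [FormalMultilinearSeries.sum, planarGAF, hp,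
    FormalMultilinearSeries.ofScalars_apply_eq, smul_eq_mul]
  exact tsum_congr fun n => by ring

lemma differentiable_planarGAF {a : ℕ → ℂ} {B c : ℝ} (hB : 0 ≤ B)
    (h : ∀ n, ‖a n‖ ≤ B * c ^ n) : Differentiable ℂ (planarGAF a) := fun z =>
  ((hasFPowerSeriesOnBall_planarGAF hB h).differentiableOn z (by simp)).differentiableAt
    (by simp)

lemma norm_planarGAF_le {a : ℕ → ℂ} {B c : ℝ} (hB : 0 ≤ B)
    (h : ∀ n, ‖a n‖ ≤ B * c ^ n) (z : ℂ) :
    ‖planarGAF a z‖ ≤ 2 * B * Real.exp (2 * (c * ‖z‖) ^ 2) := by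
  have hg : HasSum (fun n : ℕ => B * Real.exp (2 * (c * ‖z‖) ^ 2) * (1 / 2 : ℝ) ^ n)
      (B * Real.exp (2 * (c * ‖z‖) ^ 2) * 2) := by
    have := (hasSum_geometric_of_lt_one (r := (1 / 2 : ℝ)) (by norm_num) (by norm_num)).mul_left
      (B * Real.exp (2 * (c * ‖z‖) ^ 2))
    rwa [show (1 - 1 / 2 : ℝ)⁻¹ = 2 by norm_num] at this
  calc ‖planarGAF a z‖ ≤ B * Real.exp (2 * (c * ‖z‖) ^ 2) * 2 :=
        tsum_of_norm_bounded hg fun n => by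
          rw [norm_planarGAF_term]; exact planarGAF_term_le hB h (norm_nonneg z) n
    _ = _ := by ring

lemma coeff_bound_of_norm_planarGAF_le {a : ℕ → ℂ} {B c : ℝ} (hB : 0 ≤ B)
    (h : ∀ n, ‖a n‖ ≤ B * c ^ n) {r T : ℝ} (hr : 0 < r)
    (hT : ∀ z : ℂ, ‖z‖ = r → ‖planarGAF a z‖ ≤ T) (n : ℕ) :
    ‖a n‖ * r ^ n ≤ T * √(n.factorial : ℝ) := by
  have hp := hasFPowerSeriesOnBall_planarGAF hB h
  have h1 := Complex.norm_iteratedDeriv_le_of_forall_mem_sphere_norm_le (c := 0) n hr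
    (differentiable_planarGAF hB h).diffContOnCl (C := T) (fun z hz => hT z (by simpa using hz))
  have h2 := hp.factorial_smul (1 : ℂ) n
  rw [← iteratedDeriv_eq_iteratedFDeriv] at h2
  rw [← h2, FormalMultilinearSeries.ofScalars_apply_eq, nsmul_eq_mul, norm_mul, norm_smul,
    norm_div, Complex.norm_real, Real.norm_of_nonneg (by positivity)] at h1
  simp only [one_pow, norm_one, mul_one, Complex.norm_natCast] at h1
  rw [mul_div_assoc] at h1
  have h3 := le_of_mul_le_mul_left h1 (by positivity)
  rwa [div_le_div_iff₀ (by positivity) (by positivity)] at h3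

/-! ### Dividing out zeros of entire functions -/

lemma zeroCount_sub_mul {g : ℂ → ℂ} (hg : Differentiable ℂ g) {w : ℂ} {r : ℝ} (hw : ‖w‖ < r) :
    zeroCount (fun z => (z - w) * g z) r = 1 + zeroCount g r := by
  have h1 : ∀ z : ℂ, (analyticOrderAt (fun z => (z - w) * g z) z : ℝ≥0∞) =
      (analyticOrderAt (· - w) z : ℝ≥0∞) + (analyticOrderAt g z : ℝ≥0∞) := fun z => by
    rw [← ENat.toENNReal_add, ← analyticOrderAt_mul (by fun_prop) (hg.analyticAt z)]
    rfl
  unfold zeroCount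
  simp_rw [h1]
  rw [ENNReal.tsum_add, tsum_eq_single (⟨w, by simpa using hw⟩ : Metric.ball (0 : ℂ) r)]
  · simp
  · intro z hz
    rw [analyticOrderAt_id_sub_const_of_ne fun h => hz (Subtype.ext h)]
    simp

lemma zeroCount_eq_zero {g : ℂ → ℂ} {r : ℝ} (hg : ∀ z, ‖z‖ < r → g z ≠ 0) :
    zeroCount g r = 0 := by
  simp only [zeroCount, ENNReal.tsum_eq_zero]
  intro z
  rw [analyticOrderAt_eq_zero.2 (Or.inr (hg z (mem_ball_zero_iff.1 z.2)))]
  simp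

/-- At most `N` zeros of an entire function in a disk can be divided out, and it is exactly `N`
unless the quotient has no zeros left there. -/
lemma exists_factorization {f : ℂ → ℂ} (hf : Differentiable ℂ f) (r : ℝ) (N : ℕ) :
    ∃ (s : Multiset ℂ) (g : ℂ → ℂ), (∀ w ∈ s, ‖w‖ < r) ∧ Differentiable ℂ g ∧
      (∀ z, f z = (s.map (z - ·)).prod * g z) ∧ zeroCount f r = s.card + zeroCount g r ∧
      s.card ≤ N ∧ (s.card = N ∨ ∀ z, ‖z‖ < r → g z ≠ 0) := by
  induction N with
  | zero => exact ⟨0, f, by simp, hf, by simp, by simp, by simp, by simp⟩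
  | succ N ih =>
    obtain ⟨s, g, hs, hg, hfg, hc, hN, h⟩ := ih
    by_cases hz : ∀ z, ‖z‖ < r → g z ≠ 0
    · exact ⟨s, g, hs, hg, hfg, hc, by omega, Or.inr hz⟩
    push Not at hz
    obtain ⟨w, hw, hgw⟩ := hz
    have hcard : s.card = N := h.resolve_right fun h' => h' w hw hgw
    have hd : Differentiable ℂ (dslope g w) := by
      rw [← differentiableOn_univ] at hg ⊢
      exact (Complex.differentiableOn_dslope univ_mem).2 hg
    have hgd : g = fun z => (z - w) * dslope g w z := by
      ext z
      have := sub_smul_dslope g w z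
      rw [hgw, sub_zero, smul_eq_mul] at this
      exact this.symm
    refine ⟨w ::ₘ s, dslope g w, ?_, hd, ?_, ?_, ?_, Or.inl ?_⟩
    · simpa using ⟨hw, hs⟩
    · intro z
      rw [hfg z, Multiset.map_cons, Multiset.prod_cons]
      conv_lhs => rw [hgd]
      ring
    · rw [hc]
      conv_lhs => rw [hgd, zeroCount_sub_mul hd hw]
      simp [add_assoc]
    · simp; omega
    · simp [hcard]

lemma norm_prod_sub_le {s : Multiset ℂ} {z : ℂ} {c : ℝ} (h : ∀ w ∈ s, ‖z - w‖ ≤ c) :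
    ‖(s.map (z - ·)).prod‖ ≤ c ^ s.card := by
  induction s using Multiset.induction_on with
  | empty => simp
  | cons w s ih =>
    simp only [Multiset.mem_cons, forall_eq_or_imp] at h
    simp only [Multiset.map_cons, Multiset.prod_cons, norm_mul, Multiset.card_cons, pow_succ']
    exact mul_le_mul h.1 (ih h.2) (norm_nonneg _) ((norm_nonneg _).trans h.1)

lemma le_norm_prod_sub {s : Multiset ℂ} {z : ℂ} {c : ℝ} (hc : 0 ≤ c) (h : ∀ w ∈ s, c ≤ ‖z - w‖) :
    c ^ s.card ≤ ‖(s.map (z - ·)).prod‖ := by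
  induction s using Multiset.induction_on with
  | empty => simp
  | cons w s ih =>
    simp only [Multiset.mem_cons, forall_eq_or_imp] at h
    simp only [Multiset.map_cons, Multiset.prod_cons, norm_mul, Multiset.card_cons, pow_succ']
    exact mul_le_mul h.1 (ih h.2) (by positivity) (norm_nonneg _)

lemma norm_le_on_ball_of_le_on_sphere {g : ℂ → ℂ} {R C : ℝ}
    (hg : DiffContOnCl ℂ g (Metric.ball 0 R)) (hR : 0 < R) (hC : ∀ z, ‖z‖ = R → ‖g z‖ ≤ C) {z : ℂ}
    (hz : ‖z‖ ≤ R) : ‖g z‖ ≤ C := by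
  refine Complex.norm_le_of_forall_mem_frontier_norm_le Metric.isBounded_ball hg ?_ ?_
  · intro w hw
    rw [frontier_ball _ hR.ne'] at hw
    exact hC w (by simpa using hw)
  · rw [closure_ball _ hR.ne']
    simpa using hz

/-- An entire function with many zeros in a disk is small there compared to its size on a larger
circle. -/
lemma norm_le_of_le_zeroCount {f : ℂ → ℂ} (hf : Differentiable ℂ f) {r R M : ℝ} (hr : 0 < r)
    (hR : 2 * r ≤ R) (hM : ∀ z, ‖z‖ = R → ‖f z‖ ≤ M) {m : ℕ} (hm : (m : ℝ≥0∞) ≤ zeroCount f r)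
    {z : ℂ} (hz : ‖z‖ ≤ r) : ‖f z‖ ≤ M * (4 * r / R) ^ m := by
  obtain ⟨s, g, hs, hg, hfg, hc, hN, h⟩ := exists_factorization hf r m
  -- If the division stopped early, the quotient has no zeros in the disk and the count itself is
  -- `s.card`.
  have hcard : s.card = m := by
    refine h.elim id fun h => ?_
    rw [hc, zeroCount_eq_zero h, add_zero] at hm
    exact le_antisymm hN (by exact_mod_cast hm)
  have hR0 : 0 < R := by linarith
  -- On `|w| = R` each factor is at least `R - r ≥ R/2`; the maximum principle carries the bound on
  -- the quotient inwards.
  have hgM : ‖g z‖ ≤ M / (R / 2) ^ m := by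
    refine norm_le_on_ball_of_le_on_sphere hg.diffContOnCl hR0 (fun w hw => ?_) (by linarith)
    rw [le_div_iff₀ (by positivity), mul_comm]
    refine le_trans ?_ (hM w hw)
    rw [hfg w, norm_mul, ← hcard]
    gcongr
    refine le_norm_prod_sub (by positivity) fun v hv => ?_
    have := norm_sub_norm_le w v
    have := hs v hv
    linarith
  have hP : ‖(s.map (z - ·)).prod‖ ≤ (2 * r) ^ m := by
    rw [← hcard]
    refine norm_prod_sub_le fun v hv => ?_
    have := norm_sub_le z v
    have := hs v hv
    linarith
  rw [hfg z, norm_mul]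
  refine (mul_le_mul hP hgM (norm_nonneg _) (by positivity)).trans_eq ?_
  rw [show 4 * r / R = (2 * r) / (R / 2) by ring, div_pow (2 * r)]
  ring

lemma differentiable_prod_one_sub (t : Multiset ℂ) :
    Differentiable ℂ fun u : ℂ => (t.map fun w => 1 - u * w).prod := by
  induction t using Multiset.induction_on with
  | empty => simp
  | cons w t ih =>
    simp only [Multiset.map_cons, Multiset.prod_cons]
    exact (by fun_prop : Differentiable ℂ fun u : ℂ => 1 - u * w).mul ih

/-- The reversed polynomial `∏ (1 - u w)` equals `1` at `u = 0`, so by the maximum principle its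
modulus is at least `1` somewhere on `|u| = 1/s`; take `z = 1/u`. -/
lemma exists_norm_prod_sub_ge (t : Multiset ℂ) {s : ℝ} (hs : 0 < s) :
    ∃ z : ℂ, ‖z‖ = s ∧ s ^ t.card ≤ ‖(t.map (z - ·)).prod‖ := by
  by_contra! hcon
  have hd := differentiable_prod_one_sub t
  obtain ⟨u, hu, hmax⟩ := Complex.exists_mem_frontier_isMaxOn_norm (E := ℂ)
    (U := Metric.ball 0 s⁻¹) Metric.isBounded_ball ⟨0, by simpa⟩ hd.diffContOnCl
  rw [frontier_ball _ (by positivity)] at hu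
  have hu' : ‖u‖ = s⁻¹ := by simpa using hu
  have hu0 : u ≠ 0 := by rw [← norm_pos_iff, hu']; positivity
  have h0 : (0 : ℂ) ∈ closure (Metric.ball (0 : ℂ) s⁻¹) := subset_closure (by simpa)
  have h1 : 1 ≤ ‖(t.map fun w => 1 - u * w).prod‖ := by simpa using hmax h0
  have h2 := hcon u⁻¹ (by rw [norm_inv, hu', inv_inv])
  have h3 : (t.map fun w => 1 - u * w).prod = u ^ t.card * (t.map (u⁻¹ - ·)).prod := by
    rw [← Multiset.prod_replicate, ← Multiset.map_const', ← Multiset.prod_map_mul]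
    congr 1
    exact Multiset.map_congr rfl fun w _ => by field_simp
  rw [h3, norm_mul, norm_pow, hu'] at h1
  have : s⁻¹ ^ t.card * ‖(t.map (u⁻¹ - ·)).prod‖ < s⁻¹ ^ t.card * s ^ t.card := by gcongr
  rw [← mul_pow, inv_mul_cancel₀ hs.ne', one_pow] at this
  linarith

/-- If an entire function has fewer than `N` zeros in the disk of radius `r`, then its maximum on a
smaller circle controls its minimum on the circle of radius `r`. -/
lemma exists_le_of_zeroCount_lt {f : ℂ → ℂ} (hf : Differentiable ℂ f) {r s c D : ℝ} (hs : 0 < s)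
    (hsr : s ≤ r) (hc : 0 < c) (hfr : ∀ z, ‖z‖ = r → c ≤ ‖f z‖) (hfs : ∀ z, ‖z‖ = s → ‖f z‖ ≤ D)
    {x : ℝ} (h : zeroCount f r < ENNReal.ofReal x) :
    ∃ k : ℕ, (k : ℝ) < x ∧ c * s ^ k ≤ D * (2 * r) ^ k := by
  -- There are fewer than `x` zeros, so `⌈x⌉₊` divisions cannot all succeed and the quotient is
  -- zero-free.
  obtain ⟨t, g, ht, hg, hfg, hcount, hN, hor⟩ := exists_factorization hf r ⌈x⌉₊
  have hr : 0 < r := by linarith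
  have hk : (t.card : ℝ) < x := by
    have h1 : (t.card : ℝ≥0∞) < ENNReal.ofReal x := by
      rw [hcount] at h
      exact le_self_add.trans_lt h
    rw [← ENNReal.ofReal_natCast] at h1
    exact (ENNReal.ofReal_lt_ofReal_iff_of_nonneg (by positivity)).1 h1
  have hg0 : ∀ z, ‖z‖ < r → g z ≠ 0 :=
    hor.resolve_left fun h' => by
      rw [h'] at hk
      exact absurd (Nat.le_ceil x) (not_le.2 hk)
  have hgr : ∀ z, ‖z‖ = r → c / (2 * r) ^ t.card ≤ ‖g z‖ := fun z hz => by
    rw [div_le_iff₀ (by positivity), mul_comm]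
    refine (hfr z hz).trans ?_
    rw [hfg z, norm_mul]
    gcongr
    refine norm_prod_sub_le fun v hv => ?_
    have := norm_sub_le z v
    have := ht v hv
    linarith
  have hg1 : ∀ z ∈ closure (Metric.ball (0 : ℂ) r), g z ≠ 0 := fun z hz => by
    rw [closure_ball _ hr.ne', mem_closedBall_zero_iff] at hz
    rcases hz.lt_or_eq with hz | hz
    · exact hg0 z hz
    · have := hgr z hz
      rw [← norm_pos_iff]
      exact lt_of_lt_of_le (by positivity) this
  obtain ⟨z, hz, hPz⟩ := exists_norm_prod_sub_ge t hs
  -- Minimum principle: the maximum principle applied to `1/g`.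
  have hgz : ‖(g z)⁻¹‖ ≤ (c / (2 * r) ^ t.card)⁻¹ := by
    refine norm_le_on_ball_of_le_on_sphere (g := fun z => (g z)⁻¹) (hg.diffContOnCl.inv hg1) hr
      (fun w hw => ?_) (by linarith)
    rw [norm_inv]
    exact inv_anti₀ (by positivity) (hgr w hw)
  refine ⟨t.card, hk, ?_⟩
  rw [norm_inv] at hgz
  have hgz' := (inv_le_inv₀ (norm_pos_iff.2 (hg1 z (by
    rw [closure_ball _ hr.ne', mem_closedBall_zero_iff]; linarith))) (by positivity)).1 hgz
  have := hfs z hz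
  rw [hfg z, norm_mul] at this
  have h5 := (mul_le_mul hPz hgz' (by positivity) (by positivity)).trans this
  rw [mul_div_assoc', div_le_iff₀ (by positivity)] at h5
  linarith

/-! ### Small-ball and tail estimates for one Gaussian -/

lemma measurable_gaussian_density :
    Measurable fun z : ℂ => ENNReal.ofReal (Real.pi⁻¹ * Real.exp (-‖z‖ ^ 2)) := by fun_prop

lemma volume_complex_closedBall {t : ℝ} (ht : 0 ≤ t) :
    volume (Metric.closedBall (0 : ℂ) t) = ENNReal.ofReal (t ^ 2 * Real.pi) := by
  rw [Complex.volume_closedBall, ENNReal.ofReal_mul (by positivity), ENNReal.ofReal_pow ht]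
  congr 1
  rw [← NNReal.coe_real_pi, ENNReal.ofReal_coe_nnreal]

lemma stdComplexGaussian_closedBall_le {t : ℝ} (ht : 0 ≤ t) :
    stdComplexGaussian (Metric.closedBall 0 t) ≤ ENNReal.ofReal (t ^ 2) := by
  rw [stdComplexGaussian, withDensity_apply _ measurableSet_closedBall]
  calc _ ≤ ∫⁻ _ in Metric.closedBall (0 : ℂ) t, ENNReal.ofReal Real.pi⁻¹ := by
        refine lintegral_mono fun z => ENNReal.ofReal_le_ofReal ?_
        refine mul_le_of_le_one_right (by positivity) (Real.exp_le_one_iff.2 ?_)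
        nlinarith [norm_nonneg z]
    _ = _ := by
        rw [setLIntegral_const, volume_complex_closedBall ht, ← ENNReal.ofReal_mul (by positivity)]
        congr 1
        field_simp

lemma le_stdComplexGaussian_closedBall {t : ℝ} (ht : 0 ≤ t) (ht1 : t ≤ 1) :
    ENNReal.ofReal (t ^ 2 / 4) ≤ stdComplexGaussian (Metric.closedBall 0 t) := by
  rw [stdComplexGaussian, withDensity_apply _ measurableSet_closedBall]
  calc _ = ∫⁻ _ in Metric.closedBall (0 : ℂ) t, ENNReal.ofReal (Real.pi⁻¹ * (1 / 4)) := by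
        rw [setLIntegral_const, volume_complex_closedBall ht, ← ENNReal.ofReal_mul (by positivity)]
        congr 1
        field_simp
    _ ≤ _ := by
        refine setLIntegral_mono measurable_gaussian_density fun z hz => ?_
        refine ENNReal.ofReal_le_ofReal ?_
        gcongr
        have hz' : ‖z‖ ≤ t := mem_closedBall_zero_iff.1 hz
        have h1 : Real.exp (-1) ≤ Real.exp (-‖z‖ ^ 2) :=
          Real.exp_le_exp.2 (by nlinarith [norm_nonneg z])
        refine le_trans ?_ h1
        rw [Real.exp_neg, one_div]
        exact inv_anti₀ (Real.exp_pos 1) (by linarith [Real.exp_one_lt_d9])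

/-- Half of the exponent is spent on the bound `e^{-t²/2}`; the other half keeps the integral
finite. -/
lemma stdComplexGaussian_tail_le {t : ℝ} (ht : 0 ≤ t) :
    stdComplexGaussian {z | t < ‖z‖} ≤ ENNReal.ofReal (2 * Real.exp (-t ^ 2 / 2)) := by
  have hint : ∫ z : ℂ, Real.exp (-(1 / 2) * ‖z‖ ^ 2) = 2 * Real.pi := by
    rw [GaussianFourier.integral_rexp_neg_mul_sq_norm (by norm_num), Complex.finrank_real_complex]
    norm_num
    ring
  -- A non-integrable function would have integral `0` by convention, not `2π`.
  have hi : Integrable fun z : ℂ => Real.exp (-(1 / 2) * ‖z‖ ^ 2) :=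
    of_not_not fun h => by rw [integral_undef h] at hint; linarith [Real.pi_pos]
  have hm : MeasurableSet {z : ℂ | t < ‖z‖} := measurableSet_lt measurable_const measurable_norm
  rw [stdComplexGaussian, withDensity_apply _ hm]
  calc _ ≤ ∫⁻ z in {z : ℂ | t < ‖z‖}, ENNReal.ofReal (Real.pi⁻¹ * Real.exp (-t ^ 2 / 2)) *
          ENNReal.ofReal (Real.exp (-(1 / 2) * ‖z‖ ^ 2)) := by
        refine setLIntegral_mono (by fun_prop) fun z hz => ?_
        rw [← ENNReal.ofReal_mul (by positivity), mul_assoc, ← Real.exp_add]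
        refine ENNReal.ofReal_le_ofReal ?_
        gcongr
        have hz' : t < ‖z‖ := hz
        nlinarith
    _ ≤ ∫⁻ z : ℂ, ENNReal.ofReal (Real.pi⁻¹ * Real.exp (-t ^ 2 / 2)) *
          ENNReal.ofReal (Real.exp (-(1 / 2) * ‖z‖ ^ 2)) := setLIntegral_le_lintegral _ _
    _ = _ := by
        rw [lintegral_const_mul _ (by fun_prop), ← ofReal_integral_eq_lintegral_ofReal hi
          (ae_of_all _ fun z => (Real.exp_pos _).le), hint, ← ENNReal.ofReal_mul (by positivity)]
        congr 1
        field_simp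

/-! ### Joint events for independent coefficients -/

section Coefficients

variable {Ω : Type*} [MeasurableSpace Ω] {μ : Measure Ω} {a : ℕ → Ω → ℂ}

lemma measure_forall_mem_range (ha_law : ∀ n, HasLaw (a n) stdComplexGaussian μ)
    (ha_indep : iIndepFun a μ) {S : ℕ → Set ℂ} (hS : ∀ n, MeasurableSet (S n)) (N : ℕ) :
    μ (⋂ n ∈ Finset.range N, a n ⁻¹' S n) = ∏ n ∈ Finset.range N, stdComplexGaussian (S n) := by
  rw [ha_indep.measure_inter_preimage_eq_mul (Finset.range N) fun i _ => hS i]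
  refine Finset.prod_congr rfl fun n _ => ?_
  rw [← (ha_law n).map_eq, Measure.map_apply_of_aemeasurable (ha_law n).aemeasurable (hS n)]

lemma measure_forall_norm_le (ha_law : ∀ n, HasLaw (a n) stdComplexGaussian μ)
    (ha_indep : iIndepFun a μ) {t : ℕ → ℝ} (ht : ∀ n, 0 ≤ t n) (N : ℕ) :
    μ {ω | ∀ n < N, ‖a n ω‖ ≤ t n} ≤ ENNReal.ofReal (∏ n ∈ Finset.range N, t n ^ 2) := by
  have h := measure_forall_mem_range ha_law ha_indep (S := fun n => Metric.closedBall 0 (t n))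
    (fun n => measurableSet_closedBall) N
  have hset : {ω | ∀ n < N, ‖a n ω‖ ≤ t n} =
      ⋂ n ∈ Finset.range N, a n ⁻¹' Metric.closedBall 0 (t n) := by
    ext ω; simp
  rw [hset, h, ENNReal.ofReal_prod_of_nonneg fun n _ => by positivity]
  exact Finset.prod_le_prod' fun n _ => stdComplexGaussian_closedBall_le (ht n)

/-- Independence gives the product for finitely many coefficients; continuity from above passes to
all of them. -/
lemma le_measure_forall_mem [IsProbabilityMeasure μ]
    (ha_law : ∀ n, HasLaw (a n) stdComplexGaussian μ) (ha_indep : iIndepFun a μ) {S : ℕ → Set ℂ}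
    (hS : ∀ n, MeasurableSet (S n)) {p : ℕ → ℝ} (hp : ∀ n, 0 ≤ p n)
    (hpS : ∀ n, ENNReal.ofReal (p n) ≤ stdComplexGaussian (S n)) {c : ℝ}
    (hc : ∀ᶠ N in atTop, c ≤ ∏ n ∈ Finset.range N, p n) :
    ENNReal.ofReal c ≤ μ {ω | ∀ n, a n ω ∈ S n} := by
  have hset : {ω | ∀ n, a n ω ∈ S n} = ⋂ N, ⋂ n ∈ Finset.range N, a n ⁻¹' S n := by
    ext ω
    simp only [Set.mem_ofPred_eq, Set.mem_iInter, Finset.mem_range, Set.mem_preimage]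
    exact ⟨fun h N n _ => h n, fun h n => h (n + 1) n (by omega)⟩
  rw [hset]
  refine ge_of_tendsto (tendsto_measure_iInter_atTop (μ := μ) (fun N => ?_) ?_ ⟨0, by simp⟩) ?_
  · exact Finset.nullMeasurableSet_biInter _ fun n _ =>
      (ha_law n).aemeasurable.nullMeasurable (hS n)
  · intro M N hMN
    exact Set.biInter_subset_biInter_left (by simpa using hMN)
  · filter_upwards [hc] with N hN
    rw [Function.comp_apply, measure_forall_mem_range ha_law ha_indep hS]
    refine (ENNReal.ofReal_le_ofReal hN).trans ?_
    rw [ENNReal.ofReal_prod_of_nonneg fun n _ => hp n]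
    exact Finset.prod_le_prod' fun n _ => hpS n

/-- Union bound: `4^n ≥ 1 + n` and `B² ≥ 2` make the tail of index `n` smaller by a further `e^{-n}
≤ 2^{-n}`. -/
lemma measure_exists_norm_gt (ha_law : ∀ n, HasLaw (a n) stdComplexGaussian μ) {B : ℝ}
    (hB : 2 ≤ B ^ 2) (hB0 : 0 ≤ B) :
    μ {ω | ∃ n, B * 2 ^ n < ‖a n ω‖} ≤ ENNReal.ofReal (4 * Real.exp (-B ^ 2 / 2)) := by
  have hset : {ω | ∃ n, B * 2 ^ n < ‖a n ω‖} = ⋃ n, a n ⁻¹' {z | B * 2 ^ n < ‖z‖} := by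
    ext ω; simp
  have hs : HasSum (fun n : ℕ => 2 * Real.exp (-B ^ 2 / 2) * (1 / 2 : ℝ) ^ n)
      (4 * Real.exp (-B ^ 2 / 2)) := by
    have := (hasSum_geometric_of_lt_one (r := (1 / 2 : ℝ)) (by norm_num) (by norm_num)).mul_left
      (2 * Real.exp (-B ^ 2 / 2))
    convert! this using 1
    norm_num
    ring
  rw [hset, ← hs.tsum_eq, ENNReal.ofReal_tsum_of_nonneg (fun n => by positivity) hs.summable]
  refine (measure_iUnion_le _).trans (ENNReal.tsum_le_tsum fun n => ?_)
  have hm : MeasurableSet {z : ℂ | B * 2 ^ n < ‖z‖} :=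
    measurableSet_lt measurable_const measurable_norm
  rw [← Measure.map_apply_of_aemeasurable (ha_law n).aemeasurable hm, (ha_law n).map_eq]
  refine (stdComplexGaussian_tail_le (by positivity)).trans (ENNReal.ofReal_le_ofReal ?_)
  rw [mul_assoc]
  gcongr
  have h1 : (1 / 2 : ℝ) ^ n ≥ Real.exp (-n) := by
    rw [one_div, inv_pow, Real.exp_neg]
    refine inv_anti₀ (by positivity) ?_
    rw [← Real.exp_one_pow]
    gcongr
    linarith [Real.add_one_le_exp 1]
  have h2 : (1 : ℝ) + n ≤ (2 ^ n) ^ 2 := by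
    have h := Nat.lt_two_pow_self (n := n)
    have h' : (n : ℝ) + 1 ≤ 2 ^ n := by exact_mod_cast h
    nlinarith
  calc Real.exp (-(B * 2 ^ n) ^ 2 / 2) ≤ Real.exp (-B ^ 2 / 2 + -n) := by
        refine Real.exp_le_exp.2 ?_
        have hn : (0 : ℝ) ≤ n := n.cast_nonneg
        rw [mul_pow]
        nlinarith [mul_le_mul_of_nonneg_left h2 (sq_nonneg B)]
    _ ≤ _ := by rw [Real.exp_add]; gcongr

end Coefficients

/-! ### Many zeros versus small coefficients, deterministically -/

lemma sum_range_two_mul_sub (m : ℕ) :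
    ∑ n ∈ Finset.range m, 2 * (m - n : ℝ) = m ^ 2 + m := by
  have h : ∀ c : ℝ, ∑ n ∈ Finset.range m, 2 * (c - n : ℝ) = 2 * c * m - m ^ 2 + m := fun c => by
    induction m with
    | zero => simp
    | succ m ih => rw [Finset.sum_range_succ, ih]; push_cast; ring
  rw [h]; ring

lemma sum_range_half_pow_le (m : ℕ) : ∑ n ∈ Finset.range m, (1 / 2 : ℝ) ^ (m - n) ≤ 1 := by
  have h : ∑ n ∈ Finset.range m, (1 / 2 : ℝ) ^ (m - n) = 1 - (1 / 2) ^ m := by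
    induction m with
    | zero => simp
    | succ m ih =>
      have h1 : ∀ n ∈ Finset.range m, (1 / 2 : ℝ) ^ (m + 1 - n) = (1 / 2) ^ (m - n) * (1 / 2) :=
        fun n hn => by
          have := Finset.mem_range.1 hn
          rw [show m + 1 - n = (m - n) + 1 by omega, pow_succ]
      rw [Finset.sum_range_succ, Finset.sum_congr rfl h1, ← Finset.sum_mul, ih,
        show m + 1 - m = 1 by omega]
      ring
  rw [h]
  have : (0 : ℝ) ≤ (1 / 2) ^ m := by positivity
  linarith

/-- If all coefficients are moderate and there are at least `m` zeros, the first `m` coefficients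
are small. -/
lemma norm_coeff_le_of_le_zeroCount {b : ℕ → ℂ} {r : ℝ} {m : ℕ} (hr : 0 < r) (hm : 0 < m)
    (hrm : 2 * r ≤ √m) (hb : ∀ n, ‖b n‖ ≤ Real.exp m * 2 ^ n)
    (hz : (m : ℝ≥0∞) ≤ zeroCount (planarGAF b) r) {n : ℕ} (hn : n < m) :
    ‖b n‖ ≤ Real.exp (12 * m - (m - n) * Real.log (√m / r)) := by
  have hm0 : (0 : ℝ) < √m := by positivity
  -- `9 = 1 + 8`: `e^m` from the coefficient bound and `2(2√m)² = 8m` from the growth of the series.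
  have hM : ∀ z : ℂ, ‖z‖ = √m → ‖planarGAF b z‖ ≤ 2 * Real.exp (9 * m) := fun z hz => by
    refine (norm_planarGAF_le (Real.exp_pos _).le hb z).trans_eq ?_
    rw [mul_assoc, ← Real.exp_add, hz, mul_pow, Real.sq_sqrt (by positivity)]
    ring_nf
  have hT : ∀ z : ℂ, ‖z‖ = r →
      ‖planarGAF b z‖ ≤ Real.exp (12 * m - m * Real.log (√m / r)) := fun z hzr => by
    refine (norm_le_of_le_zeroCount (differentiable_planarGAF (Real.exp_pos _).le hb) hr hrm hM hz
      hzr.le).trans ?_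
    have h1 : Real.exp (m * Real.log (√m / r)) = (√m / r) ^ m := by
      rw [Real.exp_nat_mul, Real.exp_log (by positivity)]
    -- The constant `12` is `9 + 3`, since `2 · 4^m ≤ 8^m ≤ e^{3m}`.
    have h2 : 2 * 4 ^ m ≤ Real.exp (3 * m) := by
      rw [mul_comm (3 : ℝ), Real.exp_nat_mul]
      have h3 : (8 : ℝ) ≤ Real.exp 3 := by
        rw [show (3 : ℝ) = (3 : ℕ) by norm_num, ← Real.exp_one_pow]
        have : (2 : ℝ) ≤ Real.exp 1 := by linarith [Real.add_one_le_exp 1]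
        calc (8 : ℝ) = 2 ^ 3 := by norm_num
          _ ≤ _ := by gcongr
      calc (2 : ℝ) * 4 ^ m ≤ 2 ^ m * 4 ^ m := by
            gcongr
            exact le_self_pow₀ (by norm_num) hm.ne'
        _ = 8 ^ m := by rw [← mul_pow]; norm_num
        _ ≤ _ := by gcongr
    rw [Real.exp_sub, h1, show 4 * r / √m = 4 / (√m / r) by field_simp, div_pow, ← mul_div_assoc]
    gcongr
    calc 2 * Real.exp (9 * m) * 4 ^ m = Real.exp (9 * m) * (2 * 4 ^ m) := by ring
      _ ≤ Real.exp (9 * m) * Real.exp (3 * m) := by gcongr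
      _ = _ := by rw [← Real.exp_add]; ring_nf
  have h := coeff_bound_of_norm_planarGAF_le (Real.exp_pos _).le hb hr hT n
  have hfac : √(n.factorial : ℝ) ≤ √m ^ n := by
    refine Real.sqrt_le_iff.2 ⟨by positivity, ?_⟩
    rw [← pow_mul, mul_comm n, pow_mul, Real.sq_sqrt (by positivity)]
    have : n.factorial ≤ m ^ n := n.factorial_le_pow.trans (Nat.pow_le_pow_left hn.le n)
    exact_mod_cast this
  rw [← le_div_iff₀ (by positivity)] at h
  calc ‖b n‖ ≤ _ := h
    _ ≤ Real.exp (12 * m - m * Real.log (√m / r)) * √m ^ n / r ^ n := by gcongr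
    _ = Real.exp (12 * m - m * Real.log (√m / r)) * Real.exp (n * Real.log (√m / r)) := by
      rw [Real.exp_nat_mul, Real.exp_log (by positivity), div_pow, mul_div_assoc]
    _ = _ := by rw [← Real.exp_add]; ring_nf

/-- A crude bound, needed only for convergence. The coefficient of index `m` has no upper bound, so
it enters the constant. -/
lemma exists_bound_of_coeff_le {b : ℕ → ℂ} {m : ℕ} {q : ℝ} (hq : 0 ≤ q) (hq1 : q ≤ 1)
    (hlow : ∀ n < m, ‖b n‖ ≤ q ^ (m - n) / 8) (hhigh : ∀ k, ‖b (m + 1 + k)‖ ≤ 4 ^ (k + 1)) (n : ℕ) :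
    ‖b n‖ ≤ (1 + ‖b m‖) * 4 ^ n := by
  have h1 : (1 : ℝ) ≤ 4 ^ n := one_le_pow₀ (by norm_num)
  rcases lt_trichotomy n m with h | rfl | h
  · have h2 := hlow n h
    have h3 : q ^ (m - n) ≤ 1 := pow_le_one₀ hq hq1
    nlinarith [norm_nonneg (b m)]
  · nlinarith [norm_nonneg (b n)]
  · obtain ⟨k, rfl⟩ := Nat.exists_eq_add_of_le (Nat.succ_le_of_lt h)
    refine (hhigh k).trans ?_
    have h4 : (4 : ℝ) ^ (k + 1) ≤ 4 ^ (m.succ + k) := pow_le_pow_right₀ (by norm_num) (by omega)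
    exact h4.trans (le_mul_of_one_le_left (by positivity) (by linarith [norm_nonneg (b m)]))

/-- Relative to `|z|^m/√m!`, the weight of index `n < m` is at most `(√m/|z|)^(m-n)`, which
`q^(m-n)` turns into `2^{-(m-n)}` because `q√m = s/2 ≤ |z|/2`. Above `m` it is at most
`(|z|/√m)^(n-m) ≤ 64^{-(n-m)}`, which beats `4^(n-m)`. Each side contributes at most `1/8`. -/
lemma norm_planarGAF_sub_le {b : ℕ → ℂ} {m : ℕ} (hm : 0 < m) {q s : ℝ} (hq : 0 ≤ q)
    (hqs : q * √m = s / 2) (hq1 : q ≤ 1)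
    (hlow : ∀ n < m, ‖b n‖ ≤ q ^ (m - n) / 8) (hhigh : ∀ k, ‖b (m + 1 + k)‖ ≤ 4 ^ (k + 1))
    {z : ℂ} (hsz : s ≤ ‖z‖) (hzm : 64 * ‖z‖ ≤ √m) :
    ‖planarGAF b z - b m * z ^ m / (√(m.factorial : ℝ) : ℂ)‖ ≤
      1 / 4 * (‖z‖ ^ m / √(m.factorial : ℝ)) := by
  have hW : 0 ≤ ‖z‖ ^ m / √(m.factorial : ℝ) := by positivity
  have hm0 : (0 : ℝ) < √m := by positivity
  set W := ‖z‖ ^ m / √(m.factorial : ℝ) with hWdef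
  set t : ℕ → ℂ := fun n => b n * z ^ n / (√(n.factorial : ℝ) : ℂ) with ht
  have htn : ∀ n, ‖t n‖ = ‖b n‖ * (‖z‖ ^ n / √(n.factorial : ℝ)) := norm_planarGAF_term b z
  have hsum : Summable t := by
    refine Summable.of_norm ?_
    simp_rw [htn]
    exact summable_planarGAF_term (by positivity) (exists_bound_of_coeff_le hq hq1 hlow hhigh)
      (norm_nonneg z)
  have hsplit : planarGAF b z - t m = ∑ n ∈ Finset.range m, t n + ∑' k, t (k + (m + 1)) := by
    have h := hsum.sum_add_tsum_nat_add (m + 1)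
    rw [Finset.sum_range_succ] at h
    rw [planarGAF, ← h]
    ring
  have hlow' : ∀ n ∈ Finset.range m, ‖t n‖ ≤ W / 8 * (1 / 2) ^ (m - n) := fun n hn => by
    have hn' := Finset.mem_range.1 hn
    have hfac : √(m.factorial : ℝ) ≤ √(n.factorial : ℝ) * √m ^ (m - n) := by
      refine Real.sqrt_le_iff.2 ⟨by positivity, ?_⟩
      rw [mul_pow, ← pow_mul, mul_comm (m - n), pow_mul, Real.sq_sqrt (by positivity),
        Real.sq_sqrt (by positivity)]
      have h1 := Nat.factorial_mul_descFactorial (Nat.sub_le m n)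
      rw [Nat.sub_sub_self hn'.le] at h1
      have h2 := Nat.mul_le_mul_left n.factorial (Nat.descFactorial_le_pow m (m - n))
      rw [h1] at h2
      exact_mod_cast h2
    have hs0 : 0 ≤ s := by
      have : 0 ≤ q * √m := by positivity
      linarith
    calc ‖t n‖ ≤ q ^ (m - n) / 8 * (‖z‖ ^ n * √m ^ (m - n) / √(m.factorial : ℝ)) := by
          rw [htn]
          refine mul_le_mul (hlow n hn') ?_ (by positivity) (by positivity)
          rw [div_le_div_iff₀ (by positivity) (by positivity)]
          calc _ ≤ ‖z‖ ^ n * (√(n.factorial : ℝ) * √m ^ (m - n)) := by gcongr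
            _ = _ := by ring
      _ = (q * √m) ^ (m - n) * ‖z‖ ^ n / √(m.factorial : ℝ) / 8 := by rw [mul_pow]; ring
      _ ≤ (‖z‖ / 2) ^ (m - n) * ‖z‖ ^ n / √(m.factorial : ℝ) / 8 := by
          rw [hqs]
          gcongr
      _ = (‖z‖ ^ (m - n) * ‖z‖ ^ n) / √(m.factorial : ℝ) / 8 * (1 / 2) ^ (m - n) := by
          rw [div_eq_mul_one_div ‖z‖, mul_pow]; ring
      _ = _ := by rw [← pow_add, Nat.sub_add_cancel hn'.le]
  have hhigh' : ∀ k, ‖t (k + (m + 1))‖ ≤ W / 16 * (1 / 2) ^ k := fun k => by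
    have hfac : √(m.factorial : ℝ) * √m ^ (k + 1) ≤ √((k + (m + 1)).factorial : ℝ) := by
      refine Real.le_sqrt_of_sq_le ?_
      rw [mul_pow, ← pow_mul, mul_comm (k + 1), pow_mul, Real.sq_sqrt (by positivity),
        Real.sq_sqrt (by positivity)]
      have h1 := Nat.factorial_mul_pow_sub_le_factorial (n := m) (m := k + (m + 1)) (by omega)
      rw [show k + (m + 1) - m = k + 1 by omega] at h1
      exact_mod_cast h1
    calc ‖t (k + (m + 1))‖ ≤
          4 ^ (k + 1) * (‖z‖ ^ (k + (m + 1)) / (√(m.factorial : ℝ) * √m ^ (k + 1))) := by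
          rw [htn]
          have := hhigh k
          rw [show m + 1 + k = k + (m + 1) by ring] at this
          gcongr
      _ = W * (4 * (‖z‖ / √m)) ^ (k + 1) := by
          rw [hWdef, mul_pow, div_pow, show k + (m + 1) = m + (k + 1) by ring]
          field_simp
          ring
      _ ≤ W * (1 / 16) ^ (k + 1) := by
          have : ‖z‖ / √m ≤ 1 / 64 := by rw [div_le_div_iff₀ hm0 (by norm_num)]; linarith
          gcongr
          linarith
      _ ≤ W / 16 * (1 / 2) ^ k := by
          rw [pow_succ, div_eq_mul_one_div W, mul_assoc, mul_comm ((1 / 16 : ℝ) ^ k)]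
          gcongr
          norm_num
  have h1 : ‖∑ n ∈ Finset.range m, t n‖ ≤ W / 8 := by
    refine (norm_sum_le_of_le _ hlow').trans ?_
    rw [← Finset.mul_sum]
    exact mul_le_of_le_one_right (by positivity) (sum_range_half_pow_le m)
  have h2 : ‖∑' k, t (k + (m + 1))‖ ≤ W / 16 * 2 := by
    refine tsum_of_norm_bounded ?_ hhigh'
    have := (hasSum_geometric_of_lt_one (r := (1 / 2 : ℝ)) (by norm_num) (by norm_num)).mul_left
      (W / 16)
    rwa [show (1 - 1 / 2 : ℝ)⁻¹ = 2 by norm_num] at this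
  rw [hsplit]
  have := norm_add_le (∑ n ∈ Finset.range m, t n) (∑' k, t (k + (m + 1)))
  linarith

/-- If the term of index `m` dominates the series, there are almost `m` zeros. -/
lemma le_zeroCount_of_coeff_le {b : ℕ → ℂ} {m : ℕ} {δ K r x : ℝ} (hδ : 0 < δ)
    (hK : K ^ δ = 6) (hK1 : 1 ≤ K) (hx : 1 < x) (hmx : (1 + δ) * x ≤ m) (hr : 0 < r)
    (hrm : 64 * r ≤ √m) (hbm : 1 / 2 ≤ ‖b m‖)
    (hlow : ∀ n < m, ‖b n‖ ≤ (r / (2 * K * √m)) ^ (m - n) / 8)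
    (hhigh : ∀ k, ‖b (m + 1 + k)‖ ≤ 4 ^ (k + 1)) :
    ENNReal.ofReal x ≤ zeroCount (planarGAF b) r := by
  by_contra! hlt
  have hm : 0 < m := by
    have : (0 : ℝ) < m := by nlinarith
    exact_mod_cast this
  have hm0 : (0 : ℝ) < √m := by positivity
  set q := r / (2 * K * √m) with hqdef
  have hq : 0 ≤ q := by positivity
  have hqs : q * √m = r / K / 2 := by rw [hqdef]; field_simp
  have hq1 : q ≤ 1 := by
    rw [hqdef, div_le_one (by positivity)]
    nlinarith
  have hsr : r / K ≤ r := div_le_self hr.le hK1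
  have hA : 0 < √(m.factorial : ℝ) := by positivity
  have key := fun z : ℂ => norm_planarGAF_sub_le (z := z) hm hq hqs hq1 hlow hhigh
  have hterm := fun z : ℂ => norm_planarGAF_term b z m
  have hd := differentiable_planarGAF (by positivity) (exists_bound_of_coeff_le hq hq1 hlow hhigh)
  have hr1 : ∀ z : ℂ, ‖z‖ = r →
      (‖b m‖ - 1 / 4) * (r ^ m / √(m.factorial : ℝ)) ≤ ‖planarGAF b z‖ := fun z hz => by
    have h1 := key z (by rw [hz]; exact hsr) (by rw [hz]; exact hrm)
    have h2 := hterm z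
    have h3 := norm_sub_norm_le (b m * z ^ m / (√(m.factorial : ℝ) : ℂ)) (planarGAF b z)
    rw [norm_sub_rev] at h3
    rw [hz] at h1 h2
    linarith
  have hs1 : ∀ z : ℂ, ‖z‖ = r / K →
      ‖planarGAF b z‖ ≤ (‖b m‖ + 1 / 4) * ((r / K) ^ m / √(m.factorial : ℝ)) := fun z hz => by
    have h1 := key z (by rw [hz]) (by rw [hz]; linarith)
    have h2 := hterm z
    have h3 := norm_sub_norm_le (planarGAF b z) (b m * z ^ m / (√(m.factorial : ℝ) : ℂ))
    rw [hz] at h1 h2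
    linarith
  obtain ⟨k, hk, hle⟩ := exists_le_of_zeroCount_lt hd (by positivity) hsr
    (mul_pos (by linarith) (by positivity)) hr1 hs1 hlt
  -- The `3` comes from `|b_m| + 1/4 ≤ 3(|b_m| - 1/4)`, which is `|b_m| ≥ 1/2`.
  have h1 : K ^ m ≤ 3 * (2 * K) ^ k := by
    have h2 : (‖b m‖ - 1 / 4) * (r ^ m / √(m.factorial : ℝ)) * (r / K) ^ k ≤
        (3 * (‖b m‖ - 1 / 4)) * ((r / K) ^ m / √(m.factorial : ℝ)) * (2 * r) ^ k := by
      refine hle.trans ?_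
      gcongr
      linarith
    have hc : 0 < (‖b m‖ - 1 / 4) * (r ^ m / √(m.factorial : ℝ)) * r ^ k / (K ^ m * K ^ k) := by
      have : 0 < ‖b m‖ - 1 / 4 := by linarith
      positivity
    refine le_of_mul_le_mul_left ?_ hc
    refine (Eq.trans_le ?_ h2).trans_eq ?_
    · rw [div_pow]; field_simp
    · rw [div_pow, mul_pow, mul_pow]; field_simp
  -- `K^{δx} = 6^x = 2^x 3^x`: the `2^x` absorbs the loss in `(2K)^k`, and `3^x > 3` gives the
  -- contradiction.
  have h2 : K ^ m ≥ K ^ x * 6 ^ x := by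
    rw [← hK, ← Real.rpow_mul (by positivity), ← Real.rpow_add (by positivity),
      ← Real.rpow_natCast]
    exact Real.rpow_le_rpow_of_exponent_le hK1 (by linarith)
  have h3 : (2 * K) ^ k ≤ 2 ^ x * K ^ x := by
    rw [← Real.mul_rpow (by norm_num) (by positivity), ← Real.rpow_natCast]
    exact Real.rpow_le_rpow_of_exponent_le (by linarith) hk.le
  have h4 : (6 : ℝ) ^ x = 2 ^ x * 3 ^ x := by
    rw [← Real.mul_rpow (by norm_num) (by norm_num)]; norm_num
  have h5 : (3 : ℝ) < 3 ^ x := Real.self_lt_rpow_of_one_lt (by norm_num) hx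
  have h6 : 0 < (2 : ℝ) ^ x * K ^ x := by positivity
  rw [h4] at h2
  nlinarith

/-! ### Probability bounds at fixed radius -/

section Probability

variable {Ω : Type*} [MeasurableSpace Ω] {μ : Measure Ω} {a : ℕ → Ω → ℂ}

/-- The threshold `e^m 2^n` is exceeded with only doubly exponentially small probability, yet it
costs only a factor `e^{O(m²)}` in the main term. -/
lemma measure_le_zeroCount_le (ha_law : ∀ n, HasLaw (a n) stdComplexGaussian μ)
    (ha_indep : iIndepFun a μ) {r x : ℝ} {m : ℕ} (hr : 0 < r) (hm : 0 < m) (hmx : m ≤ x)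
    (hrm : 2 * r ≤ √m) :
    μ {ω | ENNReal.ofReal x ≤ zeroCount (planarGAF fun n => a n ω) r} ≤
      ENNReal.ofReal (4 * Real.exp (-Real.exp (2 * m) / 2)) +
      ENNReal.ofReal (Real.exp (24 * m ^ 2 - m ^ 2 * Real.log (√m / r))) := by
  have hE : Real.exp m ^ 2 = Real.exp (2 * m) := by rw [← Real.exp_nat_mul]; norm_num
  have hm1 : (1 : ℝ) ≤ m := by exact_mod_cast hm
  have hB : 2 ≤ Real.exp m ^ 2 := by
    rw [hE]
    linarith [Real.add_one_le_exp (2 * m : ℝ)]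
  have hsub : {ω | ENNReal.ofReal x ≤ zeroCount (planarGAF fun n => a n ω) r} ⊆
      {ω | ∃ n, Real.exp m * 2 ^ n < ‖a n ω‖} ∪
      {ω | ∀ n < m, ‖a n ω‖ ≤ Real.exp (12 * m - (m - n) * Real.log (√m / r))} := by
    intro ω hω
    by_cases h : ∃ n, Real.exp m * 2 ^ n < ‖a n ω‖
    · exact Or.inl h
    · push Not at h
      refine Or.inr fun n hn => norm_coeff_le_of_le_zeroCount hr hm hrm h (le_trans ?_ hω) hn
      rw [← ENNReal.ofReal_natCast]
      exact ENNReal.ofReal_le_ofReal hmx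
  refine (measure_mono hsub).trans ((measure_union_le _ _).trans (add_le_add ?_ ?_))
  · rw [← hE]
    exact measure_exists_norm_gt ha_law hB (Real.exp_pos _).le
  · refine (measure_forall_norm_le ha_law ha_indep (fun n => (Real.exp_pos _).le) m).trans
      (ENNReal.ofReal_le_ofReal ?_)
    have h1 : ∀ n : ℕ, Real.exp (12 * m - (m - n) * Real.log (√m / r)) ^ 2 =
        Real.exp (24 * m + -(2 * (m - n)) * Real.log (√m / r)) := fun n => by
      rw [← Real.exp_nat_mul]; congr 1; push_cast; ring
    have hlog : 0 ≤ Real.log (√m / r) :=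
      Real.log_nonneg (by rw [le_div_iff₀ hr]; linarith)
    simp_rw [h1]
    rw [← Real.exp_sum]
    refine Real.exp_le_exp.2 ?_
    simp only [neg_mul, Finset.sum_add_distrib, Finset.sum_neg_distrib, ← Finset.sum_mul,
      sum_range_two_mul_sub]
    simp only [Finset.sum_const, Finset.card_range, nsmul_eq_mul]
    nlinarith

/-- `11/15 = 1 - ∑ 4/16^(i+1)`. The induction needs the stronger bound `1` minus the partial sum. -/
lemma le_prod_one_sub_geometric (k : ℕ) :
    (11 / 15 : ℝ) ≤ ∏ i ∈ Finset.range k, (1 - 4 / 16 ^ (i + 1)) := by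
  have h : (11 / 15 + 4 / 15 * (1 / 16) ^ k : ℝ) ≤
      ∏ i ∈ Finset.range k, (1 - 4 / 16 ^ (i + 1)) := by
    induction k with
    | zero => norm_num
    | succ k ih =>
      rw [Finset.prod_range_succ]
      set y : ℝ := (1 / 16) ^ k with hy
      have h1 : (4 : ℝ) / 16 ^ (k + 1) = y / 4 := by
        rw [hy, pow_succ, one_div, inv_pow]; field_simp; norm_num
      have hy0 : 0 < y := by positivity
      have hy1 : y ≤ 1 := pow_le_one₀ (by norm_num) (by norm_num)
      rw [h1, pow_succ, ← hy]
      calc _ ≤ (11 / 15 + 4 / 15 * y) * (1 - y / 4) := by nlinarith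
        _ ≤ _ := by
          gcongr
          linarith
  have : (0 : ℝ) ≤ 4 / 15 * (1 / 16) ^ k := by positivity
  linarith

lemma le_measure_le_zeroCount [IsProbabilityMeasure μ]
    (ha_law : ∀ n, HasLaw (a n) stdComplexGaussian μ)
    (ha_indep : iIndepFun a μ) {m : ℕ} {δ K r x : ℝ} (hδ : 0 < δ)
    (hK : K ^ δ = 6) (hK1 : 1 ≤ K) (hx : 1 < x) (hmx : (1 + δ) * x ≤ m) (hr : 0 < r)
    (hrm : 64 * r ≤ √m) :
    ENNReal.ofReal (1 / 2 * Real.exp (-(m ^ 2 + m) * (Real.log (√m / r) + Real.log (2 * K)) - 6 * m))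
      ≤ μ {ω | ENNReal.ofReal x ≤ zeroCount (planarGAF fun n => a n ω) r} := by
  have hm0 : (0 : ℝ) < √m := by linarith
  have hν : IsProbabilityMeasure stdComplexGaussian := by
    rw [← (ha_law 0).map_eq]; exact Measure.isProbabilityMeasure_map (ha_law 0).aemeasurable
  set q := r / (2 * K * √m) with hqdef
  have hq : 0 < q := by positivity
  have hq1 : q ≤ 1 := by
    rw [hqdef, div_le_one (by positivity)]
    nlinarith
  -- Only the indices below `m` are expensive; the others together have probability at least
  -- `(3/4)(11/15) > 1/2`.
  set S : ℕ → Set ℂ := fun n => if n < m then Metric.closedBall 0 (q ^ (m - n) / 8) else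
    if n = m then {z | 1 / 2 < ‖z‖} else {z | 4 ^ (n - m) < ‖z‖}ᶜ with hSdef
  set p : ℕ → ℝ := fun n => if n < m then (q ^ (m - n) / 8) ^ 2 / 4 else
    if n = m then 3 / 4 else 1 - 4 / 16 ^ (n - m) with hpdef
  have hgt : ∀ t : ℝ, MeasurableSet {z : ℂ | t < ‖z‖} := fun t =>
    measurableSet_lt measurable_const measurable_norm
  have hS : ∀ n, MeasurableSet (S n) := fun n => by
    simp only [hSdef]
    split_ifs
    · exact measurableSet_closedBall
    · exact hgt _
    · exact (hgt _).compl
  have hp : ∀ n, 0 ≤ p n := fun n => by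
    simp only [hpdef]
    split_ifs with h1 h2
    · positivity
    · norm_num
    · have : (16 : ℝ) ^ 1 ≤ 16 ^ (n - m) := pow_le_pow_right₀ (by norm_num) (by omega)
      rw [sub_nonneg, div_le_one (by positivity)]
      linarith
  have hpS : ∀ n, ENNReal.ofReal (p n) ≤ stdComplexGaussian (S n) := fun n => by
    simp only [hpdef, hSdef]
    split_ifs with h1 h2
    · have : q ^ (m - n) ≤ 1 := pow_le_one₀ hq.le hq1
      exact le_stdComplexGaussian_closedBall (by positivity) (by linarith)
    · have hset : {z : ℂ | 1 / 2 < ‖z‖} = (Metric.closedBall 0 (1 / 2))ᶜ := by ext; simp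
      rw [hset, prob_compl_eq_one_sub measurableSet_closedBall,
        show (3 / 4 : ℝ) = 1 - (1 / 2) ^ 2 by norm_num, ENNReal.ofReal_sub _ (by norm_num),
        ENNReal.ofReal_one]
      exact tsub_le_tsub_left (stdComplexGaussian_closedBall_le (by norm_num)) _
    · rw [prob_compl_eq_one_sub (hgt _), ENNReal.ofReal_sub _ (by positivity), ENNReal.ofReal_one]
      refine tsub_le_tsub_left ((stdComplexGaussian_tail_le (by positivity)).trans
        (ENNReal.ofReal_le_ofReal ?_)) _
      have h3 : ((4 : ℝ) ^ (n - m)) ^ 2 = 16 ^ (n - m) := by rw [← pow_mul, mul_comm, pow_mul]; norm_num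
      set y : ℝ := 16 ^ (n - m) with hy
      have hy0 : 0 < y := by positivity
      rw [h3, show -y / 2 = -(y / 2) by ring, Real.exp_neg, ← div_eq_mul_inv,
        div_le_div_iff₀ (Real.exp_pos _) hy0]
      linarith [Real.add_one_le_exp (y / 2)]
  have hlogq : Real.log q = -(Real.log (√m / r) + Real.log (2 * K)) := by
    rw [← Real.log_mul (by positivity) (by positivity), ← Real.log_inv]
    congr 1
    rw [hqdef]; field_simp
  have hprod : Real.exp (-(m ^ 2 + m) * (Real.log (√m / r) + Real.log (2 * K)) - 6 * m) ≤
      ∏ n ∈ Finset.range m, p n := by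
    calc _ = ∏ n ∈ Finset.range m, Real.exp (2 * (m - n) * Real.log q + -6) := by
          rw [← Real.exp_sum, Finset.sum_add_distrib, ← Finset.sum_mul, sum_range_two_mul_sub,
            hlogq]
          simp only [Finset.sum_const, Finset.card_range, nsmul_eq_mul]
          ring_nf
      _ ≤ _ := by
          refine Finset.prod_le_prod (fun n _ => (Real.exp_pos _).le) fun n hn => ?_
          have hn' := Finset.mem_range.1 hn
          simp only [hpdef, if_pos hn']
          have h1 : Real.exp (2 * (m - n) * Real.log q) = (q ^ (m - n)) ^ 2 := by
            rw [← pow_mul, ← Real.exp_log hq, ← Real.exp_nat_mul, Real.exp_log hq]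
            push_cast [Nat.cast_sub hn'.le]
            ring_nf
          -- `256 = 8² · 4`, from the radius `q^(m-n)/8` and the small-ball constant `1/4`.
          have h2 : Real.exp (-6) ≤ 1 / 256 := by
            rw [Real.exp_neg, one_div]
            refine inv_anti₀ (by norm_num) ?_
            rw [show (6 : ℝ) = (6 : ℕ) by norm_num, ← Real.exp_one_pow]
            calc (256 : ℝ) ≤ 2.7 ^ 6 := by norm_num
              _ ≤ _ := by
                gcongr
                linarith [Real.exp_one_gt_d9]
          rw [Real.exp_add, h1]
          calc _ ≤ (q ^ (m - n)) ^ 2 * (1 / 256) := by gcongr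
            _ = _ := by ring
  have hc : ∀ᶠ N in atTop,
      1 / 2 * Real.exp (-(m ^ 2 + m) * (Real.log (√m / r) + Real.log (2 * K)) - 6 * m) ≤
      ∏ n ∈ Finset.range N, p n := by
    filter_upwards [eventually_ge_atTop (m + 1)] with N hN
    obtain ⟨k, rfl⟩ := Nat.exists_eq_add_of_le hN
    rw [Finset.prod_range_add, Finset.prod_range_succ]
    have h1 : p m = 3 / 4 := by simp [hpdef]
    have h2 : ∏ i ∈ Finset.range k, p (m + 1 + i) =
        ∏ i ∈ Finset.range k, (1 - 4 / 16 ^ (i + 1) : ℝ) := Finset.prod_congr rfl fun i _ => by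
      simp only [hpdef]
      rw [if_neg (by omega), if_neg (by omega), show m + 1 + i - m = i + 1 by omega]
    rw [h1, h2]
    have h3 := le_prod_one_sub_geometric k
    have h4 := Real.exp_pos (-(m ^ 2 + m) * (Real.log (√m / r) + Real.log (2 * K)) - 6 * m)
    calc _ ≤ (Real.exp (-(m ^ 2 + m) * (Real.log (√m / r) + Real.log (2 * K)) - 6 * m) * (3 / 4)) *
          (11 / 15) := by linarith
      _ ≤ _ := by
        have : 0 ≤ ∏ n ∈ Finset.range m, p n := Finset.prod_nonneg fun n _ => hp n
        gcongr
  refine (le_measure_forall_mem ha_law ha_indep hS hp hpS hc).trans (measure_mono fun ω hω => ?_)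
  have hω' : ∀ n, a n ω ∈ S n := hω
  refine le_zeroCount_of_coeff_le hδ hK hK1 hx hmx hr hrm ?_ ?_ ?_
  · have := hω' m
    simp only [hSdef, lt_irrefl, if_false, if_true, Set.mem_ofPred_eq] at this
    exact this.le
  · intro n hn
    have := hω' n
    simpa [hSdef, hn] using this
  · intro k
    have := hω' (m + 1 + k)
    simp only [hSdef] at this
    rw [if_neg (by omega), if_neg (by omega), show m + 1 + k - m = k + 1 by omega] at this
    simpa using this

end Probability

/-! ### Asymptotics of the exponents -/

section Asymptotics

variable {α c : ℝ} {m : ℝ → ℕ}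

lemma tendsto_inv_rpow (hα : 0 < α) : Tendsto (fun r : ℝ => (r ^ α)⁻¹) atTop (𝓝 0) :=
  (tendsto_rpow_atTop hα).inv_tendsto_atTop

lemma tendsto_log_sqrt_div_div_log (hc : 0 < c)
    (hm : Tendsto (fun r => m r / r ^ α) atTop (𝓝 c)) :
    Tendsto (fun r => Real.log (√(m r) / r) / Real.log r) atTop (𝓝 (α / 2 - 1)) := by
  have h1 : Tendsto (fun r => Real.log (m r / r ^ α) / 2 * (Real.log r)⁻¹ + (α / 2 - 1)) atTop
      (𝓝 (Real.log c / 2 * 0 + (α / 2 - 1))) :=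
    (((hm.log hc.ne').div_const 2).mul Real.tendsto_log_atTop.inv_tendsto_atTop).add_const _
  rw [mul_zero, zero_add] at h1
  refine h1.congr' ?_
  filter_upwards [eventually_gt_atTop 1, hm.eventually (lt_mem_nhds hc)] with r hr hpos
  have hr0 : 0 < r := by linarith
  have hm0 : (0 : ℝ) < m r := by
    have := mul_pos hpos (Real.rpow_pos_of_pos hr0 α)
    rwa [div_mul_cancel₀ _ (Real.rpow_pos_of_pos hr0 α).ne'] at this
  have hl := Real.log_pos hr
  rw [Real.log_div hm0.ne' (by positivity), Real.log_rpow hr0,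
    Real.log_div (Real.sqrt_ne_zero'.2 hm0) hr0.ne', Real.log_sqrt hm0.le]
  field_simp
  ring

/-- One limit for both bounds: the terms with `e`, `κ`, `t`, `τ` are all of lower order than `m² log
r`. -/
lemma tendsto_main_term_div (hα : 2 < α) (hc : 0 < c)
    (hm : Tendsto (fun r => m r / r ^ α) atTop (𝓝 c)) {γ : ℝ} (hγ : 0 < γ) (e κ t τ : ℝ) :
    Tendsto (fun r => (((m r : ℝ) ^ 2 + e * m r) * (Real.log (√(m r) / r) + κ) + t * m r + τ) /
      ((α / 2 - 1) * γ ^ 2 * r ^ (2 * α) * Real.log r)) atTop (𝓝 (c ^ 2 / γ ^ 2)) := by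
  have hw := tendsto_log_sqrt_div_div_log hc hm
  have hv := tendsto_inv_rpow (α := α) (by linarith)
  have hu : Tendsto (fun r => (Real.log r)⁻¹) atTop (𝓝 0) :=
    Real.tendsto_log_atTop.inv_tendsto_atTop
  have h := ((((hm.pow 2).add ((hm.const_mul e).mul hv)).mul (hw.add (hu.const_mul κ))).add
    (((hm.const_mul t).mul hv).mul hu)).add (((hv.pow 2).const_mul τ).mul hu)
  have h2 := h.div_const ((α / 2 - 1) * γ ^ 2)
  have hα' : α / 2 - 1 ≠ 0 := by intro h; linarith
  have hlim : ((c ^ 2 + e * c * 0) * (α / 2 - 1 + κ * 0) + t * c * 0 * 0 + τ * 0 ^ 2 * 0) /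
      ((α / 2 - 1) * γ ^ 2) = c ^ 2 / γ ^ 2 := by
    simp only [mul_zero, add_zero]
    rw [mul_comm (α / 2 - 1), mul_div_mul_right _ _ hα']
  rw [hlim] at h2
  refine h2.congr' ?_
  filter_upwards [eventually_gt_atTop 1] with r hr
  have hr0 : 0 < r := by linarith
  have hl := Real.log_pos hr
  have hp := Real.rpow_pos_of_pos hr0 α
  rw [two_mul α, Real.rpow_add hr0]
  generalize r ^ α = R at *
  generalize Real.log (√(m r) / r) = l at *
  generalize Real.log r = L at *
  generalize α / 2 - 1 = A at *
  field_simp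

lemma tendsto_natCast_div_rpow (hα : 0 < α) {y : ℝ → ℝ}
    (hy : Tendsto (fun r => y r / r ^ α) atTop (𝓝 c)) (hmy : ∀ᶠ r in atTop, |m r - y r| ≤ 1) :
    Tendsto (fun r => m r / r ^ α) atTop (𝓝 c) := by
  have h : Tendsto (fun r => (m r - y r) / r ^ α) atTop (𝓝 0) := by
    refine squeeze_zero_norm' ?_ (tendsto_inv_rpow hα)
    filter_upwards [hmy, eventually_gt_atTop 0] with r hr hr0
    have hp := Real.rpow_pos_of_pos hr0 α
    rw [norm_div, Real.norm_eq_abs, Real.norm_of_nonneg hp.le, ← one_div]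
    gcongr
  have h2 := h.add hy
  rw [zero_add] at h2
  exact h2.congr fun r => by ring

lemma tendsto_sq_add_div_rpow (hα : 2 < α) (γ : ℝ) :
    Tendsto (fun r : ℝ => (r ^ 2 + γ * r ^ α) / r ^ α) atTop (𝓝 γ) := by
  have h := (tendsto_inv_rpow (α := α - 2) (by linarith)).add_const γ
  rw [zero_add] at h
  refine h.congr' ?_
  filter_upwards [eventually_gt_atTop 0] with r hr
  rw [Real.rpow_sub hr, Real.rpow_two]
  have hp := Real.rpow_pos_of_pos hr α
  field_simp

lemma eventually_mul_le_sqrt (hα : 2 < α) (hc : 0 < c)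
    (hm : Tendsto (fun r => m r / r ^ α) atTop (𝓝 c)) (A : ℝ) :
    ∀ᶠ r in atTop, A * r ≤ √(m r) := by
  have h := (tendsto_rpow_atTop (y := α - 2) (by linarith)).atTop_mul_pos hc hm
  filter_upwards [h.eventually_ge_atTop (A ^ 2), eventually_gt_atTop 0] with r hr hr0
  refine Real.le_sqrt_of_sq_le ?_
  have hp := Real.rpow_pos_of_pos hr0 α
  rw [Real.rpow_sub hr0, Real.rpow_two, div_mul_div_comm, mul_comm (r ^ α),
    mul_div_mul_right _ _ hp.ne', le_div_iff₀ (by positivity)] at hr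
  rwa [mul_pow]

end Asymptotics

/-! ### Matching bounds and conclusion -/

/-- The exceptional event is absorbed by the main term: `e^{2m}/2 ≥ (2m)⁴/48 = m⁴/3 ≥ m³ ≥ m² l` for
`m ≥ 4`. -/
lemma four_mul_exp_neg_exp_le {m : ℕ} (hm : 4 ≤ m) {l : ℝ} (hl : l ≤ m) :
    4 * Real.exp (-Real.exp (2 * m) / 2) ≤ Real.exp (24 * m ^ 2 - m ^ 2 * l) := by
  have hm' : (4 : ℝ) ≤ m := by exact_mod_cast hm
  have h4 : (4 : ℝ) ≤ Real.exp 3 := by linarith [Real.add_one_le_exp 3]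
  have h5 := Real.pow_div_factorial_le_exp (2 * m : ℝ) (by positivity) 4
  norm_num [Nat.factorial] at h5
  calc _ ≤ Real.exp 3 * Real.exp (-Real.exp (2 * m) / 2) := by gcongr
    _ ≤ _ := by
      rw [← Real.exp_add]
      refine Real.exp_le_exp.2 ?_
      have h6 : (m : ℝ) ^ 2 * l ≤ m ^ 2 * m := by gcongr
      have h7 : (m : ℝ) ^ 3 * 4 ≤ m ^ 3 * m := by gcongr
      nlinarith

section Main

variable {Ω : Type*} [MeasurableSpace Ω] {μ : Measure Ω}
  {a : ℕ → Ω → ℂ} {α γ : ℝ}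

lemma eventually_measureReal_le (ha_law : ∀ n, HasLaw (a n) stdComplexGaussian μ)
    (ha_indep : iIndepFun a μ) (hα : 2 < α) (hγ : 0 < γ) {b : ℝ} (hb : b < 1) :
    ∀ᶠ r : ℝ in atTop,
      μ.real {ω | ENNReal.ofReal (r ^ 2 + γ * r ^ α) ≤ zeroCount (planarGAF fun n => a n ω) r} ≤
        Real.exp (-(b * ((α / 2 - 1) * γ ^ 2 * r ^ (2 * α) * Real.log r))) := by
  set m : ℝ → ℕ := fun r => ⌊r ^ 2 + γ * r ^ α⌋₊ with hmdef
  have hx : ∀ᶠ r : ℝ in atTop, 0 ≤ r ^ 2 + γ * r ^ α := by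
    filter_upwards [eventually_ge_atTop 0] with r hr
    have := Real.rpow_nonneg hr α
    positivity
  have hm : Tendsto (fun r => m r / r ^ α) atTop (𝓝 γ) := by
    refine tendsto_natCast_div_rpow (by linarith) (tendsto_sq_add_div_rpow hα γ) ?_
    filter_upwards [hx] with r hr
    have h1 := Nat.floor_le hr
    have h2 := Nat.lt_floor_add_one (r ^ 2 + γ * r ^ α)
    rw [abs_le]
    constructor <;> linarith
  -- The `log 2` accounts for bounding the sum of the two probabilities by twice the main one.
  have hlim := tendsto_main_term_div hα hγ hm hγ 0 (-24) 0 (-Real.log 2)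
  rw [div_self (by positivity)] at hlim
  filter_upwards [hlim.eventually (lt_mem_nhds hb), eventually_mul_le_sqrt hα hγ hm 2,
    eventually_gt_atTop 1, hx] with r hlt hsq hr1 hxr
  have hr0 : 0 < r := by linarith
  have hs2 : 2 < √(m r) := by linarith
  have hm4 : 4 ≤ m r := by
    have := Real.lt_sq_of_sqrt_lt (x := 4) (y := √(m r)) (by
      rwa [show (4 : ℝ) = 2 ^ 2 by norm_num, Real.sqrt_sq (by norm_num)])
    rw [Real.sq_sqrt (by positivity)] at this
    exact_mod_cast this.le
  have hl : Real.log (√(m r) / r) ≤ m r := by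
    have h1 : 0 < √(m r) / r := by positivity
    have h2 : √(m r) / r ≤ √(m r) := div_le_self (by positivity) hr1.le
    have h3 := Real.log_le_sub_one_of_pos h1
    have h4 := Real.sq_sqrt (Nat.cast_nonneg (α := ℝ) (m r))
    nlinarith
  have hbound := measure_le_zeroCount_le ha_law ha_indep (m := m r) hr0 (by omega)
    (Nat.floor_le hxr) hsq
  rw [← ENNReal.ofReal_add (by positivity) (by positivity)] at hbound
  have hreal := ENNReal.toReal_le_of_le_ofReal (by positivity) hbound
  have hD : 0 < (α / 2 - 1) * γ ^ 2 * r ^ (2 * α) * Real.log r := by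
    have := Real.log_pos hr1
    have : 0 < α / 2 - 1 := by linarith
    positivity
  rw [lt_div_iff₀ hD] at hlt
  refine hreal.trans ((add_le_add_left (four_mul_exp_neg_exp_le hm4 hl) _).trans ?_)
  rw [← two_mul]
  calc _ = Real.exp (Real.log 2 + (24 * m r ^ 2 - m r ^ 2 * Real.log (√(m r) / r))) := by
        rw [Real.exp_add, Real.exp_log (by norm_num)]
    _ ≤ _ := Real.exp_le_exp.2 (by linarith)

lemma eventually_le_measureReal [IsProbabilityMeasure μ]
    (ha_law : ∀ n, HasLaw (a n) stdComplexGaussian μ)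
    (ha_indep : iIndepFun a μ) (hα : 2 < α) (hγ : 0 < γ) {b : ℝ} (hb : 1 < b) :
    ∀ᶠ r : ℝ in atTop,
      Real.exp (-(b * ((α / 2 - 1) * γ ^ 2 * r ^ (2 * α) * Real.log r))) ≤
      μ.real {ω | ENNReal.ofReal (r ^ 2 + γ * r ^ α) ≤
        zeroCount (planarGAF fun n => a n ω) r} := by
  -- Using `(1+δ)` times as many indices multiplies the exponent by `(1+δ)²`, which must stay below
  -- `b`.
  set δ : ℝ := (√b - 1) / 2 with hδdef
  have hsb : 1 < √b := Real.lt_sqrt_of_sq_lt (by linarith)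
  have hδ : 0 < δ := by rw [hδdef]; linarith
  have hδb : (1 + δ) ^ 2 < b := by
    have h1 := Real.sq_sqrt (show 0 ≤ b by linarith)
    rw [← h1]
    gcongr
    rw [hδdef]; linarith
  set K : ℝ := 6 ^ δ⁻¹ with hKdef
  have hK : K ^ δ = 6 := Real.rpow_inv_rpow (by norm_num) hδ.ne'
  have hK1 : 1 ≤ K := Real.one_le_rpow (by norm_num) (by positivity)
  set m : ℝ → ℕ := fun r => ⌈(1 + δ) * (r ^ 2 + γ * r ^ α)⌉₊ with hmdef
  have hc : 0 < (1 + δ) * γ := by positivity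
  have hm : Tendsto (fun r => m r / r ^ α) atTop (𝓝 ((1 + δ) * γ)) := by
    refine tendsto_natCast_div_rpow (y := fun r => (1 + δ) * (r ^ 2 + γ * r ^ α)) (by linarith)
      (((tendsto_sq_add_div_rpow hα γ).const_mul (1 + δ)).congr fun r => by ring) ?_
    filter_upwards [eventually_ge_atTop 0] with r hr
    have := Real.rpow_nonneg hr α
    have h1 := Nat.le_ceil ((1 + δ) * (r ^ 2 + γ * r ^ α))
    have h2 := Nat.ceil_lt_add_one (show 0 ≤ (1 + δ) * (r ^ 2 + γ * r ^ α) by positivity)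
    rw [abs_le]
    constructor <;> linarith
  have hlim := tendsto_main_term_div hα hc hm hγ 1 (Real.log (2 * K)) 6 (Real.log 2)
  rw [mul_pow, mul_div_cancel_right₀ _ (by positivity)] at hlim
  filter_upwards [hlim.eventually (gt_mem_nhds hδb), eventually_mul_le_sqrt hα hc hm 64,
    eventually_gt_atTop 1] with r hlt hsq hr1
  have hr0 : 0 < r := by linarith
  have hp := Real.rpow_pos_of_pos hr0 α
  have hbound := le_measure_le_zeroCount ha_law ha_indep (m := m r) (x := r ^ 2 + γ * r ^ α) hδ hK
    hK1 (by nlinarith [mul_pos hγ hp]) (Nat.le_ceil _) hr0 hsq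
  rw [ENNReal.ofReal_le_iff_le_toReal (measure_ne_top _ _)] at hbound
  have hD : 0 < (α / 2 - 1) * γ ^ 2 * r ^ (2 * α) * Real.log r := by
    have := Real.log_pos hr1
    have : 0 < α / 2 - 1 := by linarith
    positivity
  rw [div_lt_iff₀ hD] at hlt
  refine le_trans ?_ hbound
  rw [one_div, ← Real.exp_log (show (0 : ℝ) < 2⁻¹ by norm_num), ← Real.exp_add, Real.log_inv]
  exact Real.exp_le_exp.2 (by linarith)

end Main

theorem theorem9p1 {Ω : Type*} [MeasurableSpace Ω] (μ : Measure Ω) [IsProbabilityMeasure μ]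
    (a : ℕ → Ω → ℂ) (ha_law : ∀ n, HasLaw (a n) stdComplexGaussian μ) (ha_indep : iIndepFun a μ)
    (α : ℝ) (hα : 2 < α) (γ : ℝ) (hγ : 0 < γ) :
    ∃ ε : ℝ → ℝ, Tendsto ε atTop (𝓝 0) ∧
      ∀ᶠ r : ℝ in atTop,
        μ.real {ω | ENNReal.ofReal (r ^ 2 + γ * r ^ α) ≤ zeroCount (planarGAF fun n => a n ω) r} =
          Real.exp (-((α / 2 - 1) * γ ^ 2 * r ^ (2 * α) * Real.log r * (1 + ε r))) := by
  set P : ℝ → ℝ := fun r =>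
    μ.real {ω | ENNReal.ofReal (r ^ 2 + γ * r ^ α) ≤ zeroCount (planarGAF fun n => a n ω) r}
  set D : ℝ → ℝ := fun r => (α / 2 - 1) * γ ^ 2 * r ^ (2 * α) * Real.log r with hDdef
  have hD : ∀ᶠ r in atTop, 0 < D r := by
    filter_upwards [eventually_gt_atTop 1] with r hr
    have := Real.log_pos hr
    have : 0 < α / 2 - 1 := by linarith
    have : 0 < r := by linarith
    simp only [hDdef]
    positivity
  -- Positivity lets `ε` be defined by solving for it through `log P`.
  have hP : ∀ᶠ r in atTop, 0 < P r :=
    (eventually_le_measureReal ha_law ha_indep hα hγ one_lt_two).mono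
      fun r hr => (Real.exp_pos _).trans_le hr
  have hlim : Tendsto (fun r => -Real.log (P r) / D r) atTop (𝓝 1) := by
    refine tendsto_order.2 ⟨fun b hb => ?_, fun b hb => ?_⟩
    · obtain ⟨b', hb', hb'1⟩ := exists_between hb
      filter_upwards [eventually_measureReal_le ha_law ha_indep hα hγ hb'1, hD, hP] with r h1 h2 h3
      rw [lt_div_iff₀ h2]
      have h4 : Real.log (P r) ≤ -(b' * D r) := (Real.log_le_iff_le_exp h3).2 h1
      have h5 : b * D r < b' * D r := by gcongr
      linarith
    · obtain ⟨b', hb', hb'1⟩ := exists_between hb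
      filter_upwards [eventually_le_measureReal ha_law ha_indep hα hγ hb', hD, hP] with r h1 h2 h3
      rw [div_lt_iff₀ h2]
      have h4 : -(b' * D r) ≤ Real.log (P r) := (Real.le_log_iff_exp_le h3).2 h1
      have h5 : b' * D r < b * D r := by gcongr
      linarith
  refine ⟨fun r => -Real.log (P r) / D r - 1, by simpa using hlim.sub_const 1, ?_⟩
  filter_upwards [hD, hP] with r h1 h2
  have h3 : -(D r * (1 + (-Real.log (P r) / D r - 1))) = Real.log (P r) := by
    field_simp
    ring
  rw [h3, Real.exp_log h2]
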